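/- Let $X$ be a complex Banach space. A graph on $X$ is a linear subspace $A\subseteq X\times X$; for $\lambda\in\mathbb{C}$ put $\lambda I+A=\{(u,\lambda u+g):(u,g)\in A\}$, and call $\lambda I+A$ boundedly invertible if its inverse relation is the graph of an operator $(\lambda I+A)^{-1}\in\mathcal{L}(X)$. A degenerate semigroup is a strongly continuous function $S\colon(0,\infty)\to\mathcal{L}(X)$ with $S_{t+s}=S_tS_s$ for all $t,s>0$ and $\sup_{t\in(0,1)}\|S_t\|<\infty$. We say that $-A$ generates $S$ if there is an $\omega\in\mathbb{R}$ such that, for all real $\lambda>\omega$, $\lambda I+A$ is boundedly invertible and $(\lambda I+A)^{-1}x=\int_0^\infty e^{-\lambda t}S_tx\,dt$ for all $x\in X$, the integral being convergent. For $\theta\in(0,\frac{\pi}{2}]$ let $\Sigma_\theta=\{z\in\mathbb{C}\setminus\{0\}:|\arg z|<\theta\}$; a degenerate semigroup is analytic if it extends analytically to some $\Sigma_\theta$. **Lemma 3.2.** For all $n\in\mathbb{N}$ let $A_n$ and $A$ be graphs on $X$ such that $-A_n$ and $-A$ generate analytic degenerate semigroups $S^{(n)}$ and $S$, respectively. Assume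 that there exists a $\theta\in(0,\frac{\pi}{2}]$ such that all $S^{(n)}$ and $S$ extend analytically to $\Sigma_\theta$ and are uniformly bounded on $\Sigma_\theta$, with a bound independent of $n$. Then $\lambda I+A_n$ and $\lambda I+A$ are boundedly invertible for all $n\in\mathbb{N}$ and all $\lambda\in\mathbb{C}$ with $\operatorname{Re}\lambda>0$, and the following assertions are equivalent. 1. $\lim_{n\to\infty}\int_0^T\|(S^{(n)}_t-S_t)f\|_X\,dt=0$ for all $T>0$ and $f\in X$. 2. $\lim_{n\to\infty}(\lambda I+A_n)^{-1}f=(\lambda I+A)^{-1}f$ for all $f\in X$ and all $\lambda\in\mathbb{C}$ with $\operatorname{Re}\lambda>0$. 3. There exists a $\lambda\in\mathbb{C}$ with $\operatorname{Re}\lambda>0$ such that $\lim_{n\to\infty}(\lambda I+A_n)^{-1}f=(\lambda I+A)^{-1}f$ for all $f\in X$. 4. For all $f\in X$ and all $\delta,T>0$ with $\delta<T$, $\lim_{n\to\infty}\sup_{t\in[\delta,T]}\|(S^{(n)}_t-S_t)f\|_X=0$. -/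

import Mathlib

open Filter Topology MeasureTheory

namespace DegSemigroup

variable {X : Type*} [NormedAddCommGroup X] [NormedSpace ℂ X]

/-- A degenerate semigroup `S : (0, ∞) → 𝓛(X)`: strongly continuous on the open interval `(0, ∞)`,
satisfying the semigroup law there, and bounded on `(0, 1)`.
It is a function on `ℝ` whose values at `t ≤ 0` play no role. -/
structure IsDegenerateSemigroup (S : ℝ → X →L[ℂ] X) : Prop where
  strongly_continuous : ∀ x : X, ContinuousOn (fun t : ℝ => S t x) (Set.Ioi 0)
  semigroup_law : ∀ t s : ℝ, 0 < t → 0 < s → S (t + s) = (S t).comp (S s)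
  bounded : ∃ C : ℝ, ∀ t ∈ Set.Ioo (0 : ℝ) 1, ‖S t‖ ≤ C

/-- `R` is the inverse of `z I + A`, where `A ⊆ X × X` is a graph (a linear relation) and
`z I + A = {(u, z u + g) : (u, g) ∈ A}`: the inverse relation `(z I + A)⁻¹` is the graph of the
bounded everywhere defined operator `R`. -/
def IsInverseAt (A : Submodule ℂ (X × X)) (z : ℂ) (R : X →L[ℂ] X) : Prop :=
  ∀ f u : X, R f = u ↔ ∃ g : X, (u, g) ∈ A ∧ z • u + g = f

/-- `z I + A` is boundedly invertible. -/
def BoundedlyInvertible (A : Submodule ℂ (X × X)) (z : ℂ) : Prop :=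
  ∃ R : X →L[ℂ] X, IsInverseAt A z R

open Classical in
/-- The operator `(z I + A)⁻¹` (with the junk value `0` if `z I + A` is not boundedly
invertible). -/
noncomputable def graphResolvent (A : Submodule ℂ (X × X)) (z : ℂ) : X →L[ℂ] X :=
  if h : BoundedlyInvertible A z then h.choose else 0

/-- `-A` is the generator of `S`: for some real `ω` and all real `r > ω`, the graph `r I + A` is
boundedly invertible and `(r I + A)⁻¹ x = ∫₀^∞ e^{-r t} S_t x dt` for all `x`, where the Laplace
integral converges. -/
def NegGenerates (A : Submodule ℂ (X × X)) (S : ℝ → X →L[ℂ] X) : Prop :=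
  ∃ ω : ℝ, ∀ r : ℝ, ω < r →
    BoundedlyInvertible A (r : ℂ) ∧
    ∀ x : X,
      IntegrableOn (fun t : ℝ => Real.exp (-(r * t)) • S t x) (Set.Ioi 0) ∧
      graphResolvent A (r : ℂ) x = ∫ t in Set.Ioi (0 : ℝ), Real.exp (-(r * t)) • S t x

/-- The open sector `{z ≠ 0 : |arg z| < θ}`. -/
def sector (θ : ℝ) : Set ℂ := {z : ℂ | z ≠ 0 ∧ |z.arg| < θ}

/-- `S` extends analytically to the sector of half-angle `θ` and this (unique) extension `E` is
bounded there by `M`. -/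
def AnalyticBoundedOnSector (S : ℝ → X →L[ℂ] X) (θ M : ℝ) : Prop :=
  ∃ E : ℂ → X →L[ℂ] X,
    DifferentiableOn ℂ E (sector θ) ∧
    (∀ t : ℝ, 0 < t → E (t : ℂ) = S t) ∧
    ∀ z ∈ sector θ, ‖E z‖ ≤ M

end DegSemigroup

/-! Fix `f` and put `u n t = (S' n t - S t) f`, bounded on the half-line uniformly in `n`. The
Laplace transform of a bounded semigroup satisfies the resolvent identity, so it inverts `z I + A`
for every `Re z > 0` once it does for one large real number; hence the transform of `u n` is the
difference of the resolvents. Local `L¹` convergence then gives resolvent convergence, the tail of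
the integral being uniformly small.

The substance is 3 → 4. The resolvent identity carries convergence from one point to all of `Re z >
0` (`tendsto_resolvent_of_tendsto`). Transforms at `1, 2, ...` are moments in the variable `exp
(-s)`, so by Weierstrass the integrals of `u n` against continuous weights tend to zero. Analyticity
enters here: the Schwarz lemma on discs in the sector makes the `u n` equicontinuous at each `t >
0`, so weights concentrated at `t` recover `u n t` (`tendsto_of_tendsto_laplace`), and compactness
makes the convergence uniform. Finally 4 → 1 is dominated convergence. -/

namespace DegSemigroup

/-! ### Laplace transforms of bounded semigroups and the resolvent identity. -/

section Laplace

variable {X : Type*} [NormedAddCommGroup X] [NormedSpace ℂ X]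

/-- The Laplace transform of a function on the open half-line. -/
noncomputable def laplace (u : ℝ → X) (z : ℂ) : X :=
  ∫ t in Set.Ioi (0 : ℝ), Complex.exp (-z * t) • u t

lemma norm_exp_neg_mul (z : ℂ) (t : ℝ) : ‖Complex.exp (-z * t)‖ = Real.exp (-z.re * t) := by
  rw [Complex.norm_exp]; simp

lemma integrableOn_laplace {u : ℝ → X} {B : ℝ} {z : ℂ} (hz : 0 < z.re)
    (hu : ContinuousOn u (Set.Ioi 0)) (hB : ∀ t, 0 < t → ‖u t‖ ≤ B) :
    IntegrableOn (fun t : ℝ => Complex.exp (-z * t) • u t) (Set.Ioi 0) := by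
  have hm : AEStronglyMeasurable (fun t : ℝ => Complex.exp (-z * t) • u t)
      (volume.restrict (Set.Ioi 0)) := by
    refine ContinuousOn.aestronglyMeasurable ?_ measurableSet_Ioi
    exact ContinuousOn.smul (by fun_prop) hu
  refine Integrable.mono' ((exp_neg_integrableOn_Ioi 0 hz).const_mul B) hm ?_
  filter_upwards [ae_restrict_mem measurableSet_Ioi] with t ht
  rw [norm_smul, norm_exp_neg_mul, mul_comm]
  exact mul_le_mul_of_nonneg_right (hB t ht) (Real.exp_pos _).le

lemma norm_laplace_le {u : ℝ → X} {B : ℝ} {z : ℂ} (hz : 0 < z.re)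
    (hB : ∀ t, 0 < t → ‖u t‖ ≤ B) : ‖laplace u z‖ ≤ B / z.re := by
  have h := norm_integral_le_of_norm_le (μ := volume.restrict (Set.Ioi (0 : ℝ)))
    (f := fun t : ℝ => Complex.exp (-z * t) • u t)
    ((exp_neg_integrableOn_Ioi 0 hz).const_mul B) (by
      filter_upwards [ae_restrict_mem measurableSet_Ioi] with t ht
      rw [norm_smul, norm_exp_neg_mul, mul_comm]
      exact mul_le_mul_of_nonneg_right (hB t ht) (Real.exp_pos _).le)
  refine h.trans (le_of_eq ?_)
  rw [integral_const_mul, integral_exp_mul_Ioi (by linarith)]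
  simp [div_eq_mul_inv]

lemma setIntegral_Ioi_comp_add (k : ℝ → X) (t : ℝ) :
    ∫ s in Set.Ioi (0 : ℝ), k (t + s) = ∫ s in Set.Ioi t, k s := by
  have h := (measurePreserving_add_left (volume : Measure ℝ) t).setIntegral_preimage_emb
    (measurableEmbedding_addLeft t) k (Set.Ioi t)
  rw [← h]
  congr 2
  ext s
  simp

/-- If `t ↦ S t` is a bounded semigroup, its Laplace transforms form a pseudo-resolvent. -/
lemma laplace_resolvent_identity [CompleteSpace X] {S : ℝ → X →L[ℂ] X}
    (hS : IsDegenerateSemigroup S) {M : ℝ} (hM : ∀ t, 0 < t → ‖S t‖ ≤ M) {z w : ℂ}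
    (hz : 0 < z.re) (hw : 0 < w.re) (f : X) :
    laplace (fun t => S t f) w = laplace (fun t => S t f) z +
      (z - w) • laplace (fun t => S t (laplace (fun s => S s f) w)) z := by
  have hb : ∀ g : X, ∀ t, 0 < t → ‖S t g‖ ≤ M * ‖g‖ := fun g t ht =>
    (S t).le_of_opNorm_le (hM t ht) g
  set R := laplace (fun s => S s f) w with hR
  set k : ℝ → X := fun t => Complex.exp (-w * t) • S t f with hk
  have hkI : IntegrableOn k (Set.Ioi 0) :=
    integrableOn_laplace hw (hS.strongly_continuous f) (hb f)
  have hkI' : Integrable ((Set.Ioi 0).indicator k) := by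
    rwa [integrable_indicator_iff measurableSet_Ioi]
  -- For `t ≥ 0` this is the integral of `k` over `(t, ∞)`. The indicator discards the arbitrary
  -- values of `S` at `t ≤ 0`, so `G` is continuous on all of `ℝ`.
  set G : ℝ → X := fun t => R - ∫ s in (0:ℝ)..t, (Set.Ioi 0).indicator k s with hG
  have hGcont : Continuous G :=
    continuous_const.sub (intervalIntegral.continuous_primitive
      (fun a b => hkI'.intervalIntegrable) 0)
  have hGval : ∀ t, 0 < t → S t R = Complex.exp (w * t) • G t := by
    intro t ht
    have h1 : S t R = ∫ s in Set.Ioi (0:ℝ), Complex.exp (w * t) • k (t + s) := by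
      rw [hR, laplace, ← ContinuousLinearMap.integral_comp_comm _ hkI]
      refine setIntegral_congr_fun measurableSet_Ioi fun s hs => ?_
      simp only [hk, map_smul]
      rw [hS.semigroup_law t s ht hs, smul_smul, ← Complex.exp_add]
      simp only [ContinuousLinearMap.comp_apply]
      congr 2
      push_cast
      ring
    rw [h1, integral_smul, setIntegral_Ioi_comp_add]
    congr 1
    have h2 := intervalIntegral.integral_Ioi_sub_Ioi hkI ht.le
    have h3 : ∫ s in (0:ℝ)..t, (Set.Ioi 0).indicator k s = ∫ s in (0:ℝ)..t, k s := by
      rw [intervalIntegral.integral_of_le ht.le, intervalIntegral.integral_of_le ht.le]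
      refine setIntegral_congr_fun measurableSet_Ioc fun s hs => ?_
      simp [Set.indicator, hs.1]
    simp only [hG, h3, ← h2]
    rw [hR, laplace]
    abel
  have hGderiv : ∀ t, 0 < t → HasDerivAt G (-(k t)) t := by
    intro t ht
    have hkc : ContinuousOn k (Set.Ioi 0) :=
      ContinuousOn.smul (by fun_prop) (hS.strongly_continuous f)
    have hev : (Set.Ioi (0:ℝ)).indicator k =ᶠ[𝓝 t] k := by
      filter_upwards [Ioi_mem_nhds ht] with s hs
      simp only [Set.indicator_of_mem hs]
    have hca : ContinuousAt ((Set.Ioi (0:ℝ)).indicator k) t :=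
      (hkc.continuousAt (Ioi_mem_nhds ht)).congr hev.symm
    have := (intervalIntegral.integral_hasDerivAt_right
      (hkI'.intervalIntegrable (a := 0) (b := t))
      hkI'.aestronglyMeasurable.stronglyMeasurableAtFilter hca).const_sub R
    rwa [hev.eq_of_nhds] at this
  -- For `t > 0` this equals `exp (-z t) S_t R`, but it is also continuous at `0`, with value `R`.
  -- Integrating its derivative `φ` over the half-line yields the identity without Fubini.
  set Φ : ℝ → X := fun t => Complex.exp (-(z - w) * t) • G t with hΦ
  set φ : ℝ → X := fun t =>
    -((z - w) • (Complex.exp (-z * t) • S t R)) - Complex.exp (-z * t) • S t f with hφ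
  have i1 : IntegrableOn (fun t : ℝ => Complex.exp (-z * t) • S t R) (Set.Ioi 0) :=
    integrableOn_laplace hz (hS.strongly_continuous R) (hb R)
  have i2 : IntegrableOn (fun t : ℝ => Complex.exp (-z * t) • S t f) (Set.Ioi 0) :=
    integrableOn_laplace hz (hS.strongly_continuous f) (hb f)
  have hΦval : ∀ t, 0 < t → Φ t = Complex.exp (-z * t) • S t R := by
    intro t ht
    rw [hGval t ht, smul_smul, ← Complex.exp_add]
    simp only [hΦ]
    congr 2
    ring
  have hmain : ∫ t in Set.Ioi (0:ℝ), φ t = 0 - Φ 0 := by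
    refine integral_Ioi_of_hasDerivAt_of_tendsto ?_ ?_ ?_ ?_
    · exact Continuous.continuousWithinAt (by fun_prop)
    · intro t ht
      have he : HasDerivAt (fun t : ℝ => Complex.exp (-(z - w) * t))
          (Complex.exp (-(z - w) * t) * -(z - w)) t := by
        have := (((hasDerivAt_id t).ofReal_comp).const_mul (-(z - w))).cexp
        simpa using this
      have := he.smul (hGderiv t ht)
      refine this.congr_deriv ?_
      simp only [hφ]
      rw [hGval t ht]
      simp only [hk, smul_smul, smul_neg, ← Complex.exp_add]
      rw [show -(z - w) * (t:ℂ) + -w * t = -z * t by ring,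
        show -z * (t:ℂ) + w * t = -(z - w) * t by ring, mul_neg, neg_smul,
        mul_comm (z - w)]
      abel
    · exact (i1.smul (z - w)).neg.sub i2
    · have hlim : Tendsto (fun t : ℝ => Real.exp (-z.re * t) * (M * ‖R‖)) atTop (𝓝 0) := by
        have : Tendsto (fun t : ℝ => Real.exp (-z.re * t)) atTop (𝓝 0) :=
          Real.tendsto_exp_atBot.comp
            (tendsto_id.const_mul_atTop_of_neg (by linarith))
        simpa using this.mul_const (M * ‖R‖)
      refine squeeze_zero_norm' ?_ hlim
      filter_upwards [eventually_gt_atTop 0] with t ht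
      rw [hΦval t ht, norm_smul, norm_exp_neg_mul]
      exact mul_le_mul_of_nonneg_left (hb R t ht) (Real.exp_pos _).le
  have h0 : Φ 0 = R := by simp [hΦ, hG]
  have hsplit : ∫ t in Set.Ioi (0:ℝ), φ t =
      -((z - w) • laplace (fun t => S t R) z) - laplace (fun t => S t f) z := by
    simp only [hφ]
    refine (integral_sub ((i1.smul (z - w)).neg) i2).trans ?_
    congr 1
    exact (integral_neg _).trans (congrArg Neg.neg (integral_smul _ _))
  rw [hsplit, h0] at hmain
  calc R = -(0 - R) := by abel
    _ = _ := by rw [← hmain]; abel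

/-- The Laplace transform of a bounded semigroup, as a bounded operator. -/
lemma exists_laplace_operator [CompleteSpace X] {S : ℝ → X →L[ℂ] X}
    (hS : IsDegenerateSemigroup S) {M : ℝ} (hM : ∀ t, 0 < t → ‖S t‖ ≤ M) {z : ℂ}
    (hz : 0 < z.re) :
    ∃ R : X →L[ℂ] X, (∀ f, R f = laplace (fun t => S t f) z) ∧ ‖R‖ ≤ M / z.re := by
  have hb : ∀ g : X, ∀ t, 0 < t → ‖S t g‖ ≤ M * ‖g‖ := fun g t ht =>
    (S t).le_of_opNorm_le (hM t ht) g
  have hM0 : 0 ≤ M := (norm_nonneg _).trans (hM 1 one_pos)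
  refine ⟨LinearMap.mkContinuous
    { toFun := fun f => laplace (fun t => S t f) z
      map_add' := fun f g => ?_
      map_smul' := fun c f => ?_ } (M / z.re) (fun f => ?_), fun f => rfl,
    LinearMap.mkContinuous_norm_le _ (by positivity) _⟩
  · simp only [laplace, map_add, smul_add]
    exact integral_add (integrableOn_laplace hz (hS.strongly_continuous f) (hb f))
      (integrableOn_laplace hz (hS.strongly_continuous g) (hb g))
  · simp only [laplace, map_smul, RingHom.id_apply]
    rw [← integral_smul]
    simp only [smul_comm c]
  · refine (norm_laplace_le hz (hb f)).trans (le_of_eq ?_)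
    ring

end Laplace

/-! ### A Tauberian theorem from polynomial approximation. -/

section Tauberian

variable {X : Type*} [NormedAddCommGroup X] [NormedSpace ℂ X]

/-- A continuous nonnegative weight in `exp (-s)` concentrated near `s = t`. -/
lemma exists_weight {t η : ℝ} (ht : 0 < t) (hη : 0 < η) :
    ∃ h : ℝ → ℝ, Continuous h ∧ (∀ x, 0 ≤ h x) ∧
      (∀ s, η ≤ |s - t| → h (Real.exp (-s)) = 0) ∧
      IntegrableOn (fun s => Real.exp (-s) * h (Real.exp (-s))) (Set.Ioi 0) ∧
      0 < ∫ s in Set.Ioi (0 : ℝ), Real.exp (-s) * h (Real.exp (-s)) := by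
  -- Continuity of `-log` lets a tent of radius `ρ` around `exp (-t)` vanish whenever `|s - t| ≥ η`.
  have hc : ContinuousAt (fun x => -Real.log x) (Real.exp (-t)) :=
    (Real.continuousAt_log (Real.exp_ne_zero _)).neg
  obtain ⟨ρ, hρ, hρ'⟩ := Metric.continuousAt_iff.1 hc η hη
  have hcont : Continuous fun x : ℝ => max 0 (ρ - |x - Real.exp (-t)|) := by fun_prop
  have hint : IntegrableOn (fun s => Real.exp (-s) * max 0 (ρ - |Real.exp (-s) - Real.exp (-t)|))
      (Set.Ioi 0) := by
    have h1 : IntegrableOn (fun s : ℝ => Real.exp (-1 * s) * ρ) (Set.Ioi 0) :=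
      (exp_neg_integrableOn_Ioi 0 one_pos).mul_const ρ
    refine Integrable.mono' h1 (Continuous.aestronglyMeasurable (by fun_prop)) ?_
    refine Eventually.of_forall fun s => ?_
    rw [norm_mul, Real.norm_eq_abs, Real.norm_eq_abs, abs_of_pos (Real.exp_pos _),
      abs_of_nonneg (le_max_left _ _), neg_one_mul]
    refine mul_le_mul_of_nonneg_left (max_le hρ.le ?_) (Real.exp_pos _).le
    linarith [abs_nonneg (Real.exp (-s) - Real.exp (-t))]
  refine ⟨fun x => max 0 (ρ - |x - Real.exp (-t)|), hcont, fun x => le_max_left _ _, ?_, hint, ?_⟩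
  · intro s hs
    refine max_eq_left ?_
    by_contra! hlt
    have := hρ' (x := Real.exp (-s)) (by rw [Real.dist_eq]; linarith)
    simp only [Real.log_exp, Real.dist_eq, neg_neg] at this
    linarith
  · refine (setIntegral_pos_iff_support_of_nonneg_ae (Eventually.of_forall fun s =>
      mul_nonneg (Real.exp_pos _).le (le_max_left _ _)) hint).2 ?_
    refine IsOpen.measure_pos volume (IsOpen.inter ?_ isOpen_Ioi) ⟨t, ?_, ht⟩
    · exact Continuous.isOpen_support (by fun_prop)
    · simp only [Function.mem_support, sub_self, abs_zero, sub_zero, max_eq_right hρ.le]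
      positivity

/-- Convergence of Laplace transforms at the positive integers implies convergence of integrals
against continuous functions of `exp (-s)`. -/
lemma tendsto_integral_comp_exp {u : ℕ → ℝ → X} {B : ℝ}
    (hu : ∀ n, ContinuousOn (u n) (Set.Ioi 0)) (hB : ∀ n t, 0 < t → ‖u n t‖ ≤ B)
    (hlap : ∀ k : ℕ, Tendsto (fun n => laplace (u n) ((k : ℂ) + 1)) atTop (𝓝 0))
    {h : ℝ → ℝ} (hh : Continuous h) :
    Tendsto (fun n => ∫ s in Set.Ioi (0 : ℝ), (Real.exp (-s) * h (Real.exp (-s))) • u n s)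
      atTop (𝓝 0) := by
  have hB0 : 0 ≤ B := (norm_nonneg _).trans (hB 0 1 one_pos)
  have hre : ∀ k : ℕ, 0 < ((k : ℂ) + 1).re := fun k => by
    simp only [Complex.add_re, Complex.natCast_re, Complex.one_re]; positivity
  have hmono : ∀ (k : ℕ) (a : ℝ) (n : ℕ) (s : ℝ),
      (Real.exp (-s) * (a * Real.exp (-s) ^ k)) • u n s =
        a • (Complex.exp (-((k : ℂ) + 1) * s) • u n s) := by
    intro k a n s
    have : Complex.exp (-((k : ℂ) + 1) * s) = ((Real.exp (-s) ^ (k + 1) : ℝ) : ℂ) := by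
      push_cast
      rw [← Complex.exp_nat_mul]
      congr 1
      push_cast
      ring
    rw [this, Complex.coe_smul, smul_smul]
    congr 1
    ring
  have hpoly : ∀ p : Polynomial ℝ,
      (∀ n, IntegrableOn (fun s => (Real.exp (-s) * p.eval (Real.exp (-s))) • u n s)
        (Set.Ioi 0)) ∧
      Tendsto (fun n => ∫ s in Set.Ioi (0 : ℝ),
        (Real.exp (-s) * p.eval (Real.exp (-s))) • u n s) atTop (𝓝 0) := by
    intro p
    induction p using Polynomial.induction_on' with
    | add p q hp hq =>
      have e : ∀ n s, (Real.exp (-s) * (p + q).eval (Real.exp (-s))) • u n s =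
          (Real.exp (-s) * p.eval (Real.exp (-s))) • u n s +
          (Real.exp (-s) * q.eval (Real.exp (-s))) • u n s := by
        intro n s
        rw [Polynomial.eval_add, mul_add, add_smul]
      simp only [e]
      refine ⟨fun n => (hp.1 n).add (hq.1 n), ?_⟩
      have := hp.2.add hq.2
      rw [add_zero] at this
      refine this.congr fun n => ?_
      rw [integral_add (hp.1 n) (hq.1 n)]
    | monomial k a =>
      simp only [Polynomial.eval_monomial, hmono]
      refine ⟨fun n => (integrableOn_laplace (hre k) (hu n) (hB n)).smul a, ?_⟩
      have := (hlap k).const_smul a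
      rw [smul_zero] at this
      refine this.congr fun n => ?_
      rw [integral_smul]
      rfl
  rw [Metric.tendsto_atTop]
  intro ε hε
  -- As `exp (-s)` has integral `1`, the error is at most `ε B / (2 (B + 1)) < ε / 2`; using `B + 1`
  -- also covers `B = 0`.
  obtain ⟨p, hp⟩ := exists_polynomial_near_of_continuousOn 0 1 h hh.continuousOn
    (ε / (2 * (B + 1))) (by positivity)
  obtain ⟨N, hN⟩ := Metric.tendsto_atTop.1 (hpoly p).2 (ε / 2) (by positivity)
  refine ⟨N, fun n hn => ?_⟩
  have h1 := hN n hn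
  rw [dist_zero_right] at h1 ⊢
  set q : ℝ → X := fun s =>
    (Real.exp (-s) * h (Real.exp (-s)) - Real.exp (-s) * p.eval (Real.exp (-s))) • u n s with hq
  have hbound : ∀ s ∈ Set.Ioi (0 : ℝ),
      ‖q s‖ ≤ ε / (2 * (B + 1)) * B * Real.exp (-1 * s) := by
    intro s hs
    have hx : Real.exp (-s) ∈ Set.Icc (0 : ℝ) 1 :=
      ⟨(Real.exp_pos _).le, Real.exp_le_one_iff.2 (by simpa using (Set.mem_Ioi.1 hs).le)⟩
    simp only [hq]
    rw [norm_smul, ← mul_sub, norm_mul, Real.norm_eq_abs, Real.norm_eq_abs,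
      abs_of_pos (Real.exp_pos _), abs_sub_comm, neg_one_mul]
    calc _ ≤ Real.exp (-s) * (ε / (2 * (B + 1))) * B := by
          gcongr
          · exact (hp _ hx).le
          · exact hB n s hs
      _ = _ := by ring
  have hexp := (exp_neg_integrableOn_Ioi 0 one_pos).const_mul (ε / (2 * (B + 1)) * B)
  have hqI : IntegrableOn q (Set.Ioi 0) := by
    refine Integrable.mono' hexp (ContinuousOn.aestronglyMeasurable ?_ measurableSet_Ioi) ?_
    · have hw : Continuous fun s : ℝ =>
          Real.exp (-s) * h (Real.exp (-s)) - Real.exp (-s) * p.eval (Real.exp (-s)) := by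
        fun_prop
      exact hw.continuousOn.smul (hu n)
    · filter_upwards [ae_restrict_mem measurableSet_Ioi] with s hs using hbound s hs
  have hqle : ‖∫ s in Set.Ioi (0 : ℝ), q s‖ < ε / 2 := by
    have := norm_integral_le_of_norm_le hexp (f := q) (by
      filter_upwards [ae_restrict_mem measurableSet_Ioi] with s hs using hbound s hs)
    refine this.trans_lt ?_
    rw [integral_const_mul, integral_exp_mul_Ioi (by norm_num)]
    simp only [mul_zero, Real.exp_zero, neg_div_neg_eq, div_one, mul_one]
    rw [div_mul_eq_mul_div, div_lt_div_iff₀ (by positivity) (by positivity)]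
    nlinarith
  have hsplit : ∫ s in Set.Ioi (0 : ℝ), (Real.exp (-s) * h (Real.exp (-s))) • u n s =
      (∫ s in Set.Ioi (0 : ℝ), q s) +
        ∫ s in Set.Ioi (0 : ℝ), (Real.exp (-s) * p.eval (Real.exp (-s))) • u n s := by
    rw [← integral_add hqI ((hpoly p).1 n)]
    refine integral_congr_ae (Eventually.of_forall fun s => ?_)
    simp only [hq, ← add_smul, sub_add_cancel]
  rw [hsplit]
  refine (norm_add_le _ _).trans_lt ?_
  linarith

/-- A Tauberian theorem: for a bounded sequence of continuous functions on `(0, ∞)` that is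
equicontinuous at `t`, convergence of the Laplace transforms implies convergence at `t`. -/
lemma tendsto_of_tendsto_laplace [CompleteSpace X] {u : ℕ → ℝ → X} {B : ℝ}
    (hu : ∀ n, ContinuousOn (u n) (Set.Ioi 0)) (hB : ∀ n t, 0 < t → ‖u n t‖ ≤ B)
    (hlap : ∀ k : ℕ, Tendsto (fun n => laplace (u n) ((k : ℂ) + 1)) atTop (𝓝 0))
    {t : ℝ} (ht : 0 < t)
    (hequi : ∀ ε > 0, ∃ η > 0, ∀ n s, 0 < s → |s - t| < η → ‖u n s - u n t‖ ≤ ε) :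
    Tendsto (fun n => u n t) atTop (𝓝 0) := by
  rw [Metric.tendsto_atTop]
  intro ε hε
  obtain ⟨η, hη, hclose⟩ := hequi (ε / 2) (by positivity)
  obtain ⟨h, hcont, hnn, hsupp, hint, hpos⟩ := exists_weight ht hη
  set c := ∫ s in Set.Ioi (0 : ℝ), Real.exp (-s) * h (Real.exp (-s)) with hc
  obtain ⟨N, hN⟩ := Metric.tendsto_atTop.1 (tendsto_integral_comp_exp hu hB hlap hcont)
    (c * (ε / 2)) (by positivity)
  refine ⟨N, fun n hn => ?_⟩
  have h1 := hN n hn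
  rw [dist_zero_right] at h1 ⊢
  have hbound : ∀ s ∈ Set.Ioi (0 : ℝ),
      ‖(Real.exp (-s) * h (Real.exp (-s))) • (u n s - u n t)‖ ≤
        Real.exp (-s) * h (Real.exp (-s)) * (ε / 2) := by
    intro s hs
    have hw : 0 ≤ Real.exp (-s) * h (Real.exp (-s)) := mul_nonneg (Real.exp_pos _).le (hnn _)
    rw [norm_smul, Real.norm_eq_abs, abs_of_nonneg hw]
    rcases lt_or_ge |s - t| η with hlt | hge
    · exact mul_le_mul_of_nonneg_left (hclose n s hs hlt) hw
    · simp [hsupp s hge]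
  have hI : IntegrableOn (fun s => (Real.exp (-s) * h (Real.exp (-s))) • (u n s - u n t))
      (Set.Ioi 0) := by
    refine Integrable.mono' (hint.mul_const (ε / 2))
      (ContinuousOn.aestronglyMeasurable ?_ measurableSet_Ioi) ?_
    · have hw : Continuous fun s : ℝ => Real.exp (-s) * h (Real.exp (-s)) := by fun_prop
      exact hw.continuousOn.smul ((hu n).sub continuousOn_const)
    · filter_upwards [ae_restrict_mem measurableSet_Ioi] with s hs using hbound s hs
  have h2 : ‖∫ s in Set.Ioi (0 : ℝ), (Real.exp (-s) * h (Real.exp (-s))) • (u n s - u n t)‖ ≤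
      c * (ε / 2) := by
    have := norm_integral_le_of_norm_le (hint.mul_const (ε / 2)) (f := fun s =>
      (Real.exp (-s) * h (Real.exp (-s))) • (u n s - u n t)) (by
      filter_upwards [ae_restrict_mem measurableSet_Ioi] with s hs using hbound s hs)
    rwa [integral_mul_const] at this
  -- Replacing `u n s` by `u n t` costs at most `c * (ε / 2)`, since the weight lives where `|s - t|
  -- < η`.
  have h3 : ∫ s in Set.Ioi (0 : ℝ), (Real.exp (-s) * h (Real.exp (-s))) • u n s =
      (∫ s in Set.Ioi (0 : ℝ), (Real.exp (-s) * h (Real.exp (-s))) • (u n s - u n t)) +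
        c • u n t := by
    rw [hc, ← integral_smul_const, ← integral_add hI (hint.smul_const _)]
    refine integral_congr_ae (Eventually.of_forall fun s => ?_)
    simp only [← smul_add, sub_add_cancel]
  have h4 : c * ‖u n t‖ < c * ε := by
    have : c • u n t = (∫ s in Set.Ioi (0 : ℝ), (Real.exp (-s) * h (Real.exp (-s))) • u n s) -
      ∫ s in Set.Ioi (0 : ℝ), (Real.exp (-s) * h (Real.exp (-s))) • (u n s - u n t) := by
      rw [h3]; abel
    have h5 : ‖c • u n t‖ = c * ‖u n t‖ := by
      rw [norm_smul, Real.norm_eq_abs, abs_of_pos hpos]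
    rw [← h5, this]
    refine (norm_sub_le _ _).trans_lt ?_
    linarith
  exact lt_of_mul_lt_mul_left h4 hpos.le

end Tauberian

/-! ### Analyticity estimates and resolvents of graphs. -/

section Resolvent

variable {X : Type*} [NormedAddCommGroup X] [NormedSpace ℂ X]

lemma AnalyticBoundedOnSector.norm_le {S : ℝ → X →L[ℂ] X} {θ M : ℝ} (hθ : 0 < θ)
    (h : AnalyticBoundedOnSector S θ M) {t : ℝ} (ht : 0 < t) : ‖S t‖ ≤ M := by
  obtain ⟨E, -, hE, hM⟩ := h
  rw [← hE t ht]
  refine hM _ ⟨by exact_mod_cast ht.ne', ?_⟩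
  rwa [Complex.arg_ofReal_of_nonneg ht.le, abs_zero]

/-- Positive scaling preserves the argument, so a ball around `1` inside the sector can be dilated
by `t`. -/
lemma exists_ball_subset_sector {θ : ℝ} (hθ : 0 < θ) :
    ∃ c > 0, ∀ t : ℝ, 0 < t → Metric.ball (t : ℂ) (c * t) ⊆ sector θ := by
  have hca : ContinuousAt (fun z : ℂ => |z.arg|) 1 :=
    (Complex.continuousAt_arg Complex.one_mem_slitPlane).abs
  have hev : ∀ᶠ z : ℂ in 𝓝 1, |z.arg| < θ :=
    hca.eventually_lt continuousAt_const (by simpa using hθ)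
  have hne : ∀ᶠ z : ℂ in 𝓝 1, z ≠ 0 := isOpen_ne.mem_nhds one_ne_zero
  obtain ⟨c, hc, hcs⟩ := Metric.eventually_nhds_iff.1 (hne.and hev)
  refine ⟨c, hc, fun t ht z hz => ?_⟩
  have ht' : (t : ℂ) ≠ 0 := by exact_mod_cast ht.ne'
  have hzt : z = t * (z / t) := by field_simp
  obtain ⟨h1, h2⟩ := hcs (y := z / t) (by
    rw [Complex.dist_eq, div_sub_one ht', norm_div, Complex.norm_real, Real.norm_eq_abs,
      abs_of_pos ht, div_lt_iff₀ ht]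
    rwa [Metric.mem_ball, Complex.dist_eq] at hz)
  rw [hzt]
  exact ⟨mul_ne_zero ht' h1, by rwa [Complex.arg_real_mul _ ht]⟩

/-- Bounded analytic semigroups are locally Lipschitz, with a constant that depends only on the
sector and on the bound. -/
lemma exists_lipschitz_of_analyticBounded {θ M : ℝ} (hθ : 0 < θ) :
    ∃ c > 0, ∀ S : ℝ → X →L[ℂ] X, AnalyticBoundedOnSector S θ M →
      ∀ t s : ℝ, 0 < t → 0 < s → |s - t| < c * t →
        ‖S s - S t‖ ≤ (M + M) / (c * t) * |s - t| := by
  obtain ⟨c, hc, hcs⟩ := exists_ball_subset_sector hθ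
  refine ⟨c, hc, fun S ⟨E, hd, hE, hM⟩ t s ht hs hst => ?_⟩
  have hd' : dist (s : ℂ) (t : ℂ) = |s - t| := by
    rw [Complex.dist_eq, ← Complex.ofReal_sub, Complex.norm_real, Real.norm_eq_abs]
  -- Schwarz lemma: `E` maps the disc into the closed ball of radius `M + M` around `E t`.
  have := Complex.dist_le_div_mul_dist_of_mapsTo_ball (f := E) (c := (t : ℂ)) (z := (s : ℂ))
    (R₁ := c * t) (R₂ := M + M) (hd.mono (hcs t ht)) (fun z hz => by
      rw [mem_closedBall_iff_norm]
      exact (norm_sub_le _ _).trans (add_le_add (hM z (hcs t ht hz))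
        (hM _ (hcs t ht (Metric.mem_ball_self (by positivity))))))
    (by rwa [Metric.mem_ball, hd'])
  rwa [hd', dist_eq_norm, hE s hs, hE t ht] at this

lemma IsInverseAt.unique {A : Submodule ℂ (X × X)} {z : ℂ} {R R' : X →L[ℂ] X}
    (h : IsInverseAt A z R) (h' : IsInverseAt A z R') : R = R' := by
  ext f
  exact (h f (R' f)).2 ((h' f (R' f)).1 rfl)

lemma IsInverseAt.graphResolvent_eq {A : Submodule ℂ (X × X)} {z : ℂ} {R : X →L[ℂ] X}
    (h : IsInverseAt A z R) : graphResolvent A z = R := by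
  have hb : BoundedlyInvertible A z := ⟨R, h⟩
  rw [graphResolvent, dif_pos hb]
  exact hb.choose_spec.unique h

/-- If `-A` generates the bounded semigroup `S`, then the Laplace transform of `S` is the resolvent
of the graph on the whole right half-plane. -/
lemma NegGenerates.isInverseAt_laplace [CompleteSpace X] {A : Submodule ℂ (X × X)}
    {S : ℝ → X →L[ℂ] X} (hA : NegGenerates A S) (hS : IsDegenerateSemigroup S) {M : ℝ}
    (hM : ∀ t, 0 < t → ‖S t‖ ≤ M) {z : ℂ} (hz : 0 < z.re) {R : X →L[ℂ] X}
    (hR : ∀ f, R f = laplace (fun t => S t f) z) : IsInverseAt A z R := by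
  obtain ⟨ω, hω⟩ := hA
  -- Above `ω`, so that generation applies, and positive, so that the resolvent identity does.
  set r : ℝ := max ω 0 + 1 with hr
  have hr0 : 0 < (r : ℂ).re := by
    rw [Complex.ofReal_re]; linarith [le_max_right ω 0]
  obtain ⟨⟨Q, hQ⟩, hQ'⟩ := hω r (by linarith [le_max_left ω 0])
  have hQlap : ∀ f, Q f = laplace (fun t => S t f) r := by
    intro f
    rw [← hQ.graphResolvent_eq, (hQ' f).2, laplace]
    refine setIntegral_congr_fun measurableSet_Ioi fun t _ => ?_
    rw [← Complex.coe_smul]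
    push_cast
    rw [neg_mul]
  have id1 : ∀ f, R f = Q f + ((r : ℂ) - z) • Q (R f) := by
    intro f
    rw [hR f, hQlap, hQlap]
    exact laplace_resolvent_identity hS hM hr0 hz f
  have id2 : ∀ f, Q f = R f + (z - r) • R (Q f) := by
    intro f
    rw [hQlap f, hR, hR]
    exact laplace_resolvent_identity hS hM hz hr0 f
  intro f u
  -- Adding `(r - z) u` to both sides moves the equation from `z` to `r`, where `Q` solves it.
  have key : (∃ g, (u, g) ∈ A ∧ z • u + g = f) ↔ Q (f + ((r : ℂ) - z) • u) = u := by
    rw [hQ]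
    refine exists_congr fun g => and_congr_right fun _ => ?_
    rw [sub_smul]
    constructor
    · rintro rfl; abel
    · intro h
      have h' : z • u + g = (r : ℂ) • u + g - ((r : ℂ) • u - z • u) := by abel
      rw [h', h]
      abel
  rw [key]
  constructor
  · rintro rfl
    rw [map_add, map_smul, ← id1]
  · intro h
    have h2 := id2 (f + ((r : ℂ) - z) • u)
    rw [h, map_add, map_smul, sub_smul, sub_smul] at h2
    rw [h2]
    abel

/-- If `-A` generates a semigroup bounded by `M`, then on the right half-plane `(z I + A)⁻¹` exists,
is the Laplace transform of the semigroup, and is bounded by `M / Re z`. -/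
lemma NegGenerates.exists_resolvent [CompleteSpace X] {A : Submodule ℂ (X × X)}
    {S : ℝ → X →L[ℂ] X} (hA : NegGenerates A S) (hS : IsDegenerateSemigroup S) {M : ℝ}
    (hM : ∀ t, 0 < t → ‖S t‖ ≤ M) {z : ℂ} (hz : 0 < z.re) :
    IsInverseAt A z (graphResolvent A z) ∧
      (∀ f, graphResolvent A z f = laplace (fun t => S t f) z) ∧
      ‖graphResolvent A z‖ ≤ M / z.re := by
  obtain ⟨R, hR, hRM⟩ := exists_laplace_operator hS hM hz
  have h := hA.isInverseAt_laplace hS hM hz hR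
  rw [h.graphResolvent_eq]
  exact ⟨h, hR, hRM⟩

/-- Strong convergence of pseudo-resolvents at one point gives strong convergence at any other
point at which they are bounded. -/
lemma tendsto_resolvent_of_tendsto {R₁ R₂ : ℕ → X →L[ℂ] X} {Q₁ Q₂ : X →L[ℂ] X} {a : ℂ} {C : ℝ}
    (hC : ∀ n, ‖R₂ n‖ ≤ C)
    (hR : ∀ n f, R₂ n f = R₁ n f + a • R₂ n (R₁ n f))
    (hQ : ∀ f, Q₂ f = Q₁ f + a • Q₁ (Q₂ f))
    (h : ∀ f, Tendsto (fun n => R₁ n f) atTop (𝓝 (Q₁ f))) (f : X) :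
    Tendsto (fun n => R₂ n f) atTop (𝓝 (Q₂ f)) := by
  -- Chosen so that `Q₁ g = Q₂ f`; the error at the new point is then `I + a R₂` applied to the
  -- error of `R₁` at the fixed vector `g`.
  set g := f + a • Q₂ f with hg
  have hQg : Q₁ g = Q₂ f := by rw [hg, map_add, map_smul, ← hQ]
  have hlim : Tendsto (fun n => R₁ n g - Q₁ g) atTop (𝓝 0) :=
    tendsto_sub_nhds_zero_iff.2 (h g)
  have key : ∀ n, R₂ n f - Q₂ f = (R₁ n g - Q₁ g) + a • R₂ n (R₁ n g - Q₁ g) := by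
    intro n
    have h1 := hR n g
    rw [hQg, map_sub, smul_sub]
    have h2 : R₂ n f = R₂ n g - a • R₂ n (Q₂ f) := by
      rw [hg, map_add, map_smul]; abel
    rw [h2, h1]
    abel
  rw [← tendsto_sub_nhds_zero_iff]
  simp only [key]
  have h0 : Tendsto (fun n => a • R₂ n (R₁ n g - Q₁ g)) atTop (𝓝 0) := by
    have hb : Tendsto (fun n => ‖a‖ * (C * ‖R₁ n g - Q₁ g‖)) atTop (𝓝 0) := by
      simpa using (hlim.norm.const_mul C).const_mul ‖a‖
    refine squeeze_zero_norm (fun n => ?_) hb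
    rw [norm_smul]
    exact mul_le_mul_of_nonneg_left ((R₂ n).le_of_opNorm_le (hC n) _) (norm_nonneg _)
  simpa using hlim.add h0

end Resolvent

/-! ### Passing between integral, pointwise and uniform convergence. -/

section Convergence

variable {X : Type*} [NormedAddCommGroup X]

/-- Local convergence in `L¹` of a bounded sequence implies convergence of the Laplace
transforms. -/
lemma tendsto_laplace_of_tendsto_lintegral [NormedSpace ℂ X] {u : ℕ → ℝ → X} {B : ℝ}
    (hB : ∀ n t, 0 < t → ‖u n t‖ ≤ B)
    (h : ∀ T : ℝ, 0 < T →
      Tendsto (fun n => ∫⁻ t in Set.Ioo (0 : ℝ) T, ‖u n t‖ₑ) atTop (𝓝 0))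
    {z : ℂ} (hz : 0 < z.re) : Tendsto (fun n => laplace (u n) z) atTop (𝓝 0) := by
  have hB0 : 0 ≤ B := (norm_nonneg _).trans (hB 0 1 one_pos)
  -- Cut at `T`: the exponential is at most `1` before, and the bound `B` controls the tail
  -- uniformly in `n`.
  have hle : ∀ T : ℝ, 0 < T → ∀ n, ‖laplace (u n) z‖ₑ ≤
      (∫⁻ t in Set.Ioo (0 : ℝ) T, ‖u n t‖ₑ) +
        ENNReal.ofReal (B * (Real.exp (-z.re * T) / z.re)) := by
    intro T hT n
    have h1 : ‖laplace (u n) z‖ₑ ≤ ∫⁻ t in Set.Ioi (0 : ℝ), ‖Complex.exp (-z * t) • u n t‖ₑ :=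
      enorm_integral_le_lintegral_enorm _
    have hun : Set.Ioi (0 : ℝ) ⊆ Set.Ioo 0 T ∪ Set.Ici T := fun t ht =>
      (lt_or_ge t T).elim (fun h => Or.inl ⟨ht, h⟩) Or.inr
    refine h1.trans ((lintegral_mono_set hun).trans ((lintegral_union_le _ _ _).trans
      (add_le_add ?_ ?_)))
    · refine setLIntegral_mono' measurableSet_Ioo fun t ht => ?_
      rw [enorm_le_iff_norm_le, norm_smul, norm_exp_neg_mul]
      refine mul_le_of_le_one_left (norm_nonneg _) (Real.exp_le_one_iff.2 ?_)
      nlinarith [ht.1]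
    · have hI : IntegrableOn (fun t => B * Real.exp (-z.re * t)) (Set.Ici T) := by
        rw [integrableOn_Ici_iff_integrableOn_Ioi]
        exact (exp_neg_integrableOn_Ioi T hz).const_mul B
      have hval : ∫ t in Set.Ici T, B * Real.exp (-z.re * t) =
          B * (Real.exp (-z.re * T) / z.re) := by
        rw [integral_Ici_eq_integral_Ioi, integral_const_mul,
          integral_exp_mul_Ioi (by linarith), neg_div_neg_eq]
      rw [← hval, ofReal_integral_eq_lintegral_ofReal hI (Eventually.of_forall fun t => by
        positivity)]
      refine setLIntegral_mono' measurableSet_Ici fun t ht => ?_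
      rw [← ofReal_norm]
      refine ENNReal.ofReal_le_ofReal ?_
      rw [norm_smul, norm_exp_neg_mul, mul_comm]
      exact mul_le_mul_of_nonneg_right (hB n t (hT.trans_le ht)) (Real.exp_pos _).le
  have htail : Tendsto (fun T : ℝ => ENNReal.ofReal (B * (Real.exp (-z.re * T) / z.re)))
      atTop (𝓝 0) := by
    have h1 : Tendsto (fun T : ℝ => Real.exp (-z.re * T)) atTop (𝓝 0) :=
      Real.tendsto_exp_atBot.comp (tendsto_id.const_mul_atTop_of_neg (by linarith))
    have h2 := (h1.div_const z.re).const_mul B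
    simpa using ENNReal.tendsto_ofReal h2
  rw [tendsto_zero_iff_enorm_tendsto_zero, ENNReal.tendsto_nhds_zero]
  intro ε hε
  have hε2 : 0 < ε / 2 := ENNReal.half_pos hε.ne'
  obtain ⟨T, hT, hT0⟩ :=
    ((ENNReal.tendsto_nhds_zero.1 htail _ hε2).and (eventually_gt_atTop 0)).exists
  filter_upwards [ENNReal.tendsto_nhds_zero.1 (h T hT0) _ hε2] with n hn
  exact (hle T hT0 n).trans ((add_le_add hn hT).trans (ENNReal.add_halves ε).le)

/-- Pointwise convergence together with equicontinuity gives uniform convergence on compact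
intervals. -/
lemma tendsto_iSup_of_equicontinuous {u : ℕ → ℝ → X} {δ T : ℝ} (hδ : 0 < δ)
    (hequi : ∀ t > 0, ∀ ε > 0, ∃ η > 0, ∀ n s, 0 < s → |s - t| < η → ‖u n s - u n t‖ ≤ ε)
    (h : ∀ t > 0, Tendsto (fun n => u n t) atTop (𝓝 0)) :
    Tendsto (fun n => ⨆ t ∈ Set.Icc δ T, ‖u n t‖ₑ) atTop (𝓝 0) := by
  rw [ENNReal.tendsto_nhds_zero]
  intro ε hε
  obtain ⟨e, he, heε⟩ : ∃ e : ℝ, 0 < e ∧ ENNReal.ofReal e ≤ ε := by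
    obtain ⟨q, hq, hqε⟩ := ENNReal.lt_iff_exists_nnreal_btwn.1 hε
    exact ⟨q, by exact_mod_cast hq, by simpa using hqε.le⟩
  suffices hs : ∀ᶠ n in atTop, ∀ t ∈ Set.Icc δ T, ‖u n t‖ ≤ e by
    filter_upwards [hs] with n hn
    refine iSup₂_le fun t ht => le_trans ?_ heε
    rw [← ofReal_norm]
    exact ENNReal.ofReal_le_ofReal (hn t ht)
  -- Eventual smallness passes to subsets and finite unions, so it need only be checked near each
  -- point, where equicontinuity supplies it.
  refine isCompact_Icc.induction_on (p := fun s => ∀ᶠ n in atTop, ∀ t ∈ s, ‖u n t‖ ≤ e)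
    (by simp) (fun s t hst ht => ht.mono fun n hn x hx => hn x (hst hx))
    (fun s t hs ht => (hs.and ht).mono fun n hn x hx => hx.elim (hn.1 x) (hn.2 x)) ?_
  intro t ht
  have ht0 : 0 < t := hδ.trans_le ht.1
  obtain ⟨η, hη, hη'⟩ := hequi t ht0 (e / 2) (by positivity)
  refine ⟨Metric.ball t η ∩ Set.Ioi 0, mem_nhdsWithin_of_mem_nhds
    (inter_mem (Metric.ball_mem_nhds t hη) (Ioi_mem_nhds ht0)), ?_⟩
  have hev : ∀ᶠ n in atTop, ‖u n t‖ < e / 2 := by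
    have := (h t ht0).norm
    rw [norm_zero] at this
    exact this.eventually_lt_const (by positivity)
  filter_upwards [hev] with n hn s hs
  have h1 := hη' n s hs.2 hs.1
  have h2 : u n s = (u n s - u n t) + u n t := by abel
  rw [h2]
  exact (norm_add_le _ _).trans (by linarith)

/-- Pointwise convergence of a bounded sequence of continuous functions implies convergence in
`L¹` on bounded intervals. -/
lemma tendsto_lintegral_of_tendsto {u : ℕ → ℝ → X} {B : ℝ}
    (hu : ∀ n, ContinuousOn (u n) (Set.Ioi 0)) (hB : ∀ n t, 0 < t → ‖u n t‖ ≤ B)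
    (h : ∀ t > 0, Tendsto (fun n => u n t) atTop (𝓝 0)) (T : ℝ) :
    Tendsto (fun n => ∫⁻ t in Set.Ioo (0 : ℝ) T, ‖u n t‖ₑ) atTop (𝓝 0) := by
  have := tendsto_lintegral_of_dominated_convergence'
    (μ := volume.restrict (Set.Ioo (0 : ℝ) T)) (F := fun n t => ‖u n t‖ₑ) (f := fun _ => 0)
    (fun _ => ENNReal.ofReal B)
    (fun n => (((hu n).mono Set.Ioo_subset_Ioi_self).aestronglyMeasurable
      measurableSet_Ioo).enorm)
    (fun n => by
      filter_upwards [ae_restrict_mem measurableSet_Ioo] with t ht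
      rw [← ofReal_norm]
      exact ENNReal.ofReal_le_ofReal (hB n t ht.1))
    (by
      rw [setLIntegral_const, Real.volume_Ioo]
      exact ENNReal.mul_ne_top ENNReal.ofReal_ne_top ENNReal.ofReal_ne_top)
    (by
      filter_upwards [ae_restrict_mem measurableSet_Ioo] with t ht
      exact tendsto_zero_iff_enorm_tendsto_zero.1 (h t ht.1))
  simpa using this

end Convergence

end DegSemigroup

/-! ### The equivalence. -/

theorem lemma3p2 {X : Type*} [NormedAddCommGroup X] [NormedSpace ℂ X] [CompleteSpace X]
    (A' : ℕ → Submodule ℂ (X × X)) (A : Submodule ℂ (X × X))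
    (S' : ℕ → ℝ → X →L[ℂ] X) (S : ℝ → X →L[ℂ] X)
    (hS' : ∀ n, DegSemigroup.IsDegenerateSemigroup (S' n))
    (hS : DegSemigroup.IsDegenerateSemigroup S)
    (hA' : ∀ n, DegSemigroup.NegGenerates (A' n) (S' n))
    (hA : DegSemigroup.NegGenerates A S)
    (hbdd : ∃ θ : ℝ, 0 < θ ∧ θ ≤ Real.pi / 2 ∧ ∃ M : ℝ,
      (∀ n, DegSemigroup.AnalyticBoundedOnSector (S' n) θ M) ∧
      DegSemigroup.AnalyticBoundedOnSector S θ M) :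
    (∀ z : ℂ, 0 < z.re →
      (∀ n, DegSemigroup.BoundedlyInvertible (A' n) z) ∧
      DegSemigroup.BoundedlyInvertible A z) ∧
    List.TFAE [
      ∀ T : ℝ, 0 < T → ∀ f : X,
        Tendsto (fun n => ∫⁻ t in Set.Ioo (0 : ℝ) T, ‖(S' n t - S t) f‖ₑ) atTop (𝓝 0),
      ∀ z : ℂ, 0 < z.re → ∀ f : X,
        Tendsto (fun n => DegSemigroup.graphResolvent (A' n) z f) atTop
          (𝓝 (DegSemigroup.graphResolvent A z f)),
      ∃ z : ℂ, 0 < z.re ∧ ∀ f : X,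
        Tendsto (fun n => DegSemigroup.graphResolvent (A' n) z f) atTop
          (𝓝 (DegSemigroup.graphResolvent A z f)),
      ∀ f : X, ∀ δ T : ℝ, 0 < δ → δ < T →
        Tendsto (fun n => ⨆ t ∈ Set.Icc δ T, ‖(S' n t - S t) f‖ₑ) atTop (𝓝 0)] := by
  obtain ⟨θ, hθ, -, M, hE', hE⟩ := hbdd
  have hM : ∀ t, 0 < t → ‖S t‖ ≤ M := fun t ht => hE.norm_le hθ ht
  have hM' : ∀ n t, 0 < t → ‖S' n t‖ ≤ M := fun n t ht => (hE' n).norm_le hθ ht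
  have hM0 : 0 ≤ M := (norm_nonneg _).trans (hM 1 one_pos)
  have hres := fun (z : ℂ) (hz : 0 < z.re) => hA.exists_resolvent hS hM hz
  have hres' := fun n (z : ℂ) (hz : 0 < z.re) => (hA' n).exists_resolvent (hS' n) (hM' n) hz
  have hu : ∀ f n, ContinuousOn (fun t => (S' n t - S t) f) (Set.Ioi 0) := fun f n =>
    ((hS' n).strongly_continuous f).sub (hS.strongly_continuous f)
  have hB : ∀ f n t, 0 < t → ‖(S' n t - S t) f‖ ≤ (M + M) * ‖f‖ := fun f n t ht =>
    ContinuousLinearMap.le_of_opNorm_le _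
      ((norm_sub_le _ _).trans (add_le_add (hM' n t ht) (hM t ht))) f
  have hsub : ∀ (z : ℂ), 0 < z.re → ∀ f n,
      DegSemigroup.laplace (fun t => (S' n t - S t) f) z =
        DegSemigroup.graphResolvent (A' n) z f - DegSemigroup.graphResolvent A z f := by
    intro z hz f n
    rw [(hres z hz).2.1, (hres' n z hz).2.1]
    simp only [DegSemigroup.laplace, sub_apply, smul_sub]
    exact integral_sub
      (DegSemigroup.integrableOn_laplace hz ((hS' n).strongly_continuous f)
        fun t ht => (S' n t).le_of_opNorm_le (hM' n t ht) f)
      (DegSemigroup.integrableOn_laplace hz (hS.strongly_continuous f)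
        fun t ht => (S t).le_of_opNorm_le (hM t ht) f)
  have hequi : ∀ f, ∀ t > 0, ∀ ε > 0, ∃ η > 0, ∀ n s, 0 < s → |s - t| < η →
      ‖(S' n s - S s) f - (S' n t - S t) f‖ ≤ ε := by
    intro f t ht ε hε
    obtain ⟨c, hc, hlip⟩ := DegSemigroup.exists_lipschitz_of_analyticBounded (X := X) (M := M) hθ
    set K := (M + M) / (c * t) * ‖f‖ with hK
    have hK0 : 0 ≤ K := by positivity
    -- The first term keeps `s` in the Schwarz disc; the second makes the two errors `K |s - t|` sum
    -- to at most `ε`, even if `K = 0`.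
    refine ⟨min (c * t) (ε / (2 * (K + 1))), by positivity, fun n s hs hst => ?_⟩
    have hst1 := hst.trans_le (min_le_left _ _)
    have hst2 := hst.trans_le (min_le_right _ _)
    rw [lt_div_iff₀ (by positivity)] at hst2
    have h1 := ((S' n s - S' n t).le_of_opNorm_le (hlip (S' n) (hE' n) t s ht hs hst1) f)
    have h2 := ((S s - S t).le_of_opNorm_le (hlip S hE t s ht hs hst1) f)
    have h3 : (S' n s - S s) f - (S' n t - S t) f =
        (S' n s - S' n t) f - (S s - S t) f := by
      simp only [sub_apply]
      abel
    rw [h3]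
    refine (norm_sub_le _ _).trans ?_
    have h4 : (M + M) / (c * t) * |s - t| * ‖f‖ = K * |s - t| := by rw [hK]; ring
    rw [h4] at h1 h2
    nlinarith [abs_nonneg (s - t)]
  refine ⟨fun z hz => ⟨fun n => ⟨_, (hres' n z hz).1⟩, ⟨_, (hres z hz).1⟩⟩, ?_⟩
  tfae_have 1 → 2 := by
    intro h z hz f
    rw [← tendsto_sub_nhds_zero_iff]
    simp only [← hsub z hz f]
    exact DegSemigroup.tendsto_laplace_of_tendsto_lintegral (hB f) (fun T hT => h T hT f) hz
  tfae_have 2 → 3 := fun h => ⟨1, by simp, h 1 (by simp)⟩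
  tfae_have 3 → 4 := by
    rintro ⟨w, hw, h⟩ f δ T hδ -
    refine DegSemigroup.tendsto_iSup_of_equicontinuous hδ (hequi f) fun t ht =>
      DegSemigroup.tendsto_of_tendsto_laplace (hu f) (hB f) (fun k => ?_) ht (hequi f t ht)
    have hz : 0 < ((k : ℂ) + 1).re := by
      simp only [Complex.add_re, Complex.natCast_re, Complex.one_re]
      positivity
    set z : ℂ := (k : ℂ) + 1
    simp only [hsub z hz f]
    rw [tendsto_sub_nhds_zero_iff]
    -- The resolvent identity is needed in both orders of composition: with the bounded `R₂ n`
    -- outermost for the sequence, and with `Q₁` outermost for the limit.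
    refine DegSemigroup.tendsto_resolvent_of_tendsto (a := w - z)
      (fun n => (hres' n z hz).2.2) (fun n g => ?_) (fun g => ?_) h f
    · have := DegSemigroup.laplace_resolvent_identity (hS' n) (hM' n) hz hw g
      rw [← (hres' n w hw).2.1, ← (hres' n z hz).2.1, ← (hres' n z hz).2.1] at this
      rw [← neg_sub z w, neg_smul, ← sub_eq_add_neg]
      exact eq_sub_of_add_eq this.symm
    · have := DegSemigroup.laplace_resolvent_identity hS hM hw hz g
      rwa [← (hres z hz).2.1, ← (hres w hw).2.1, ← (hres w hw).2.1] at this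
  tfae_have 4 → 1 := by
    intro h T _ f
    refine DegSemigroup.tendsto_lintegral_of_tendsto (hu f) (hB f) (fun t ht => ?_) T
    rw [tendsto_zero_iff_enorm_tendsto_zero]
    -- Assertion 4 requires `δ < T`, so the value at `t` is read off from `[t, t + 1]`.
    refine tendsto_of_tendsto_of_tendsto_of_le_of_le tendsto_const_nhds
      (h f t (t + 1) ht (by linarith)) (fun n => bot_le) (fun n => ?_)
    exact le_iSup₂ (f := fun s (_ : s ∈ Set.Icc t (t + 1)) => ‖(S' n s - S s) f‖ₑ) t
      ⟨le_rfl, by linarith⟩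
  tfae_finish
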